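/- For real $v$ and $x>0$ let $$I_v(x)=\sum_{n=0}^{\infty}\frac{(x/2)^{2n+v}}{n!\,\Gamma(v+n+1)},\qquad v\notin\{-1,-2,\dots\},$$ be the modified Bessel function of the first kind, and let $$K_v(x)=\frac{\pi}{2}\,\frac{I_{-v}(x)-I_v(x)}{\sin(v\pi)}$$ be the modified Bessel function of the second kind, where for integer $v$ the right-hand side is replaced by its limiting value as the order tends to $v$. Let $v\ge 0$ and $r\in\mathbb{R}$, and put $f(x)=x^r e^x K_v(x)$ for $x>0$. (a) $f$ is increasing (in the weak sense) on $(0,\infty)$ if and only if $r\ge\max(v,1/2)$, and decreasing (in the weak sense) on $(0,\infty)$ if and only if $r\le\min(v,1/2)$. (b) If $(v,r)\ne(1/2,1/2)$, then $f$ is strictly increasing on $(0,\infty)$ if and only if $r\ge\max(v,1/2)$, and strictly decreasing on $(0,\infty)$ if and only if $r\le\min(v,1/2)$. (c) If $1/2<r<v$, then there is an $x_0>0$ such that $f$ is strictly decreasing on $(0,x_0)$ and strictly increasing on $(x_0,\infty)$. (d) If $v<r<1/2$, then there is an $x_0>0$ such that $f$ is strictly increasing on $(0,x_0)$ and strictly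 decreasing on $(x_0,\infty)$. -/

import Mathlib

open Filter Topology

/-- The modified Bessel function of the first kind, for real order `v` and `x > 0`:
`I_v(x) = ∑ (x/2)^(2n+v) / (n! Γ(v+n+1))`. -/
noncomputable def besselI (v x : ℝ) : ℝ :=
  ∑' n : ℕ, (x / 2) ^ (2 * (n : ℝ) + v) / ((n.factorial : ℝ) * Real.Gamma (v + n + 1))

/-- The quotient `(π/2) (I_{-v}(x) - I_v(x)) / sin(vπ)`, meaningful for `v` not an integer. -/
noncomputable def besselKQuot (v x : ℝ) : ℝ :=
  Real.pi / 2 * ((besselI (-v) x - besselI v x) / Real.sin (v * Real.pi))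

open Classical in
/-- The modified Bessel function of the second kind, for real order `v` and `x > 0`: the quotient
`(π/2) (I_{-v}(x) - I_v(x)) / sin(vπ)`, replaced by its limiting value (the limit as the order
tends to `v` through values different from `v`) when `v` is an integer. -/
noncomputable def besselK (v x : ℝ) : ℝ :=
  if ∃ n : ℤ, v = (n : ℝ) then limUnder (𝓝[≠] v) (fun u : ℝ => besselKQuot u x)
  else besselKQuot v x

/-- The function `x ↦ x^r e^x K_v(x)`. -/
noncomputable def powExpBesselK (v r x : ℝ) : ℝ :=
  x ^ r * Real.exp x * besselK v x

/-! Everything is read off from the slope h(x) = x + x K_v'(x)/K_v(x), because x f'/f = r + h. For v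
> 1/2 the slope is strictly increasing with -v < h < -1/2; for v < 1/2 it is strictly decreasing
with -1/2 < h < -v; for v = 1/2 it is constantly -1/2. So r + h has a constant sign when r lies
outside the open interval between v and 1/2, and changes sign exactly once when r lies inside it.

The bound by -v compares K_{v-1} with K_v. The bound by -1/2 is the sign of the Wronskian of K_v and
K_{1/2}, which vanishes at infinity and has a derivative of the sign of v² - 1/4. Monotonicity of h
has the same form: x K_v² h' vanishes at infinity and has derivative 2 K_v² (h + 1/2). The sign
change is not obtained from limits of h: for 1/2 < r < v, f tends to infinity at both ends, and for
v < r < 1/2 it tends to zero at both ends.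

These arguments use K_v = (1/2) ∫ exp(vt - x cosh t) dt. To match it with the definition, both
expressions are shown to satisfy the same first-order system in the orders v and 1 - v, with the
same behaviour at 0, for 0 < v < 1. The derivative relation raises the order by integers, symmetry
gives negative orders, and continuity in the order gives the integers. -/

/-! ### Integral representation of K_v -/

/-- The integral `(1/2) ∫ exp (v t - x cosh t) dt` over the real line, which equals `K_v(x)`. -/
noncomputable def besselKIntegral (v x : ℝ) : ℝ :=
  (∫ t : ℝ, Real.exp (v * t - x * Real.cosh t)) / 2

theorem sq_div_four_le_cosh (t : ℝ) : t ^ 2 / 4 ≤ Real.cosh t := by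
  rw [← Real.cosh_abs, Real.cosh_eq, ← sq_abs]
  have h1 := Real.quadratic_le_exp_of_nonneg (abs_nonneg t)
  have h2 := Real.exp_pos (-|t|)
  have h3 := abs_nonneg t
  linarith

/-- The bound on cosh gives Gaussian decay x t²/4. Completing the square spends half of it on the
linear term v t, which leaves x/8. -/
theorem integrable_exp_sub_cosh (v : ℝ) {x : ℝ} (hx : 0 < x) :
    MeasureTheory.Integrable (fun t : ℝ => Real.exp (v * t - x * Real.cosh t)) := by
  have hg : MeasureTheory.Integrable
      (fun t : ℝ => Real.exp (2 * v ^ 2 / x) * Real.exp (-(x / 8) * t ^ 2)) :=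
    (integrable_exp_neg_mul_sq (by positivity)).const_mul _
  refine hg.mono' (by fun_prop) (Eventually.of_forall fun t => ?_)
  rw [Real.norm_eq_abs, Real.abs_exp, ← Real.exp_add, Real.exp_le_exp]
  have h1 := mul_le_mul_of_nonneg_left (sq_div_four_le_cosh t) hx.le
  have h2 : v * t ≤ 2 * v ^ 2 / x + x / 8 * t ^ 2 := by
    have : 2 * v ^ 2 / x + x / 8 * t ^ 2 - v * t = 2 / x * (v - x * t / 4) ^ 2 := by
      field_simp; ring
    have h3 : 0 ≤ 2 / x * (v - x * t / 4) ^ 2 := by positivity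
    linarith
  linarith

theorem cosh_mul_exp_sub_cosh (v x t : ℝ) :
    Real.cosh t * Real.exp (v * t - x * Real.cosh t) =
      (Real.exp ((v + 1) * t - x * Real.cosh t) +
        Real.exp ((v - 1) * t - x * Real.cosh t)) / 2 := by
  rw [show (v + 1) * t - x * Real.cosh t = t + (v * t - x * Real.cosh t) by ring,
    show (v - 1) * t - x * Real.cosh t = -t + (v * t - x * Real.cosh t) by ring,
    Real.exp_add t, Real.exp_add (-t)]
  nth_rw 1 [Real.cosh_eq t]
  ring

theorem sinh_mul_exp_sub_cosh (v x t : ℝ) :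
    Real.sinh t * Real.exp (v * t - x * Real.cosh t) =
      (Real.exp ((v + 1) * t - x * Real.cosh t) -
        Real.exp ((v - 1) * t - x * Real.cosh t)) / 2 := by
  rw [show (v + 1) * t - x * Real.cosh t = t + (v * t - x * Real.cosh t) by ring,
    show (v - 1) * t - x * Real.cosh t = -t + (v * t - x * Real.cosh t) by ring,
    Real.exp_add t, Real.exp_add (-t)]
  nth_rw 1 [Real.sinh_eq t]
  ring

theorem integrable_cosh_mul_exp_sub_cosh (v : ℝ) {x : ℝ} (hx : 0 < x) :
    MeasureTheory.Integrable
      (fun t : ℝ => Real.cosh t * Real.exp (v * t - x * Real.cosh t)) := by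
  simp_rw [cosh_mul_exp_sub_cosh]
  exact ((integrable_exp_sub_cosh _ hx).add (integrable_exp_sub_cosh _ hx)).div_const 2

theorem hasDerivAt_besselKIntegral_aux (v : ℝ) {x : ℝ} (hx : 0 < x) :
    HasDerivAt (besselKIntegral v)
      (-(besselKIntegral (v + 1) x + besselKIntegral (v - 1) x) / 2) x := by
  -- On y > x/2 the differentiated integrand is dominated by its absolute value at x/2.
  have key := hasDerivAt_integral_of_dominated_loc_of_deriv_le (𝕜 := ℝ)
    (μ := MeasureTheory.volume)
    (F := fun x t : ℝ => Real.exp (v * t - x * Real.cosh t))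
    (F' := fun x t : ℝ => -(Real.cosh t * Real.exp (v * t - x * Real.cosh t)))
    (bound := fun t : ℝ => Real.cosh t * Real.exp (v * t - x / 2 * Real.cosh t))
    (x₀ := x) (s := Set.Ioi (x / 2)) (Ioi_mem_nhds (by linarith))
    (Eventually.of_forall fun y => by fun_prop) (integrable_exp_sub_cosh v hx)
    (by fun_prop) ?_ (integrable_cosh_mul_exp_sub_cosh v (by linarith)) ?_
  · have h := key.2.div_const 2
    refine h.congr_deriv ?_
    rw [MeasureTheory.integral_neg]
    simp_rw [cosh_mul_exp_sub_cosh]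
    rw [MeasureTheory.integral_div, MeasureTheory.integral_add (integrable_exp_sub_cosh _ hx)
      (integrable_exp_sub_cosh _ hx)]
    simp only [besselKIntegral]
    ring
  · refine Eventually.of_forall fun t y hy => ?_
    have hc := Real.cosh_pos t
    rw [norm_neg, Real.norm_eq_abs, abs_of_nonneg (by positivity)]
    have : x / 2 * Real.cosh t ≤ y * Real.cosh t :=
      mul_le_mul_of_nonneg_right (le_of_lt hy) hc.le
    gcongr
  · refine Eventually.of_forall fun t y _ => ?_
    have h1 : HasDerivAt (fun y : ℝ => v * t - y * Real.cosh t) (-(Real.cosh t)) y := by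
      simpa using ((hasDerivAt_id y).mul_const (Real.cosh t)).const_sub (v * t)
    exact h1.exp.congr_deriv (by ring)

/-- Integration by parts: the t-derivative of the integrand has integral zero over the line. -/
theorem besselKIntegral_recurrence (v : ℝ) {x : ℝ} (hx : 0 < x) :
    2 * v * besselKIntegral v x =
      x * (besselKIntegral (v + 1) x - besselKIntegral (v - 1) x) := by
  have hd : ∀ t : ℝ, HasDerivAt (fun t : ℝ => Real.exp (v * t - x * Real.cosh t))
      (v * Real.exp (v * t - x * Real.cosh t) -
        x * ((Real.exp ((v + 1) * t - x * Real.cosh t) -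
        Real.exp ((v - 1) * t - x * Real.cosh t)) / 2)) t := by
    intro t
    have h1 : HasDerivAt (fun t : ℝ => v * t - x * Real.cosh t) (v - x * Real.sinh t) t := by
      simpa using ((hasDerivAt_id t).const_mul v).fun_sub ((Real.hasDerivAt_cosh t).const_mul x)
    refine h1.exp.congr_deriv ?_
    rw [← sinh_mul_exp_sub_cosh]; ring
  have i0 := integrable_exp_sub_cosh v hx
  have ip := integrable_exp_sub_cosh (v + 1) hx
  have im := integrable_exp_sub_cosh (v - 1) hx
  have i2 : MeasureTheory.Integrable fun t : ℝ => x * ((Real.exp ((v + 1) * t - x * Real.cosh t) -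
      Real.exp ((v - 1) * t - x * Real.cosh t)) / 2) := ((ip.sub im).div_const 2).const_mul x
  have h := MeasureTheory.integral_eq_zero_of_hasDerivAt_of_integrable hd
    ((i0.const_mul v).sub i2) i0
  have e2 : ∫ t : ℝ, x * ((Real.exp ((v + 1) * t - x * Real.cosh t) -
        Real.exp ((v - 1) * t - x * Real.cosh t)) / 2) =
      x * (((∫ t : ℝ, Real.exp ((v + 1) * t - x * Real.cosh t)) -
        ∫ t : ℝ, Real.exp ((v - 1) * t - x * Real.cosh t)) / 2) := by
    rw [MeasureTheory.integral_const_mul, MeasureTheory.integral_div,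
      MeasureTheory.integral_sub ip im]
  rw [MeasureTheory.integral_sub (i0.const_mul v) i2, e2, MeasureTheory.integral_const_mul] at h
  simp only [besselKIntegral]
  linarith

theorem besselKIntegral_neg (v x : ℝ) : besselKIntegral (-v) x = besselKIntegral v x := by
  unfold besselKIntegral
  rw [← MeasureTheory.integral_neg_eq_self]
  simp

theorem besselKIntegral_pos (v : ℝ) {x : ℝ} (hx : 0 < x) : 0 < besselKIntegral v x := by
  have := MeasureTheory.integral_exp_pos (μ := MeasureTheory.volume)
    (integrable_exp_sub_cosh v hx)
  unfold besselKIntegral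
  linarith

theorem hasDerivAt_besselKIntegral (v : ℝ) {x : ℝ} (hx : 0 < x) :
    HasDerivAt (besselKIntegral v)
      (v / x * besselKIntegral v x - besselKIntegral (v + 1) x) x := by
  refine (hasDerivAt_besselKIntegral_aux v hx).congr_deriv ?_
  have := besselKIntegral_recurrence v hx
  field_simp
  linarith

theorem hasDerivAt_besselKIntegral' (v : ℝ) {x : ℝ} (hx : 0 < x) :
    HasDerivAt (besselKIntegral v)
      (-(v / x * besselKIntegral v x) - besselKIntegral (v - 1) x) x := by
  refine (hasDerivAt_besselKIntegral_aux v hx).congr_deriv ?_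
  have := besselKIntegral_recurrence v hx
  field_simp
  linarith

theorem besselKIntegral_eq_cosh (v : ℝ) {x : ℝ} (hx : 0 < x) :
    besselKIntegral v x = (∫ t : ℝ, Real.cosh (v * t) * Real.exp (-(x * Real.cosh t))) / 2 := by
  have h : (besselKIntegral v x + besselKIntegral (-v) x) / 2 = besselKIntegral v x := by
    rw [besselKIntegral_neg]; ring
  rw [← h]
  unfold besselKIntegral
  rw [← add_div, ← MeasureTheory.integral_add (integrable_exp_sub_cosh _ hx)
    (integrable_exp_sub_cosh _ hx), ← MeasureTheory.integral_div, ← MeasureTheory.integral_div,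
    ← MeasureTheory.integral_div]
  congr 1
  ext t
  rw [Real.cosh_eq (v * t), sub_eq_add_neg, sub_eq_add_neg, Real.exp_add, Real.exp_add]
  simp only [neg_mul]
  ring

theorem integrable_cosh_mul_exp_neg (v : ℝ) {x : ℝ} (hx : 0 < x) : MeasureTheory.Integrable
    (fun t : ℝ => Real.cosh (v * t) * Real.exp (-(x * Real.cosh t))) := by
  refine (((integrable_exp_sub_cosh v hx).add
    (integrable_exp_sub_cosh (-v) hx)).div_const 2).congr (Eventually.of_forall fun t => ?_)
  simp only [Pi.add_apply]
  rw [Real.cosh_eq (v * t), sub_eq_add_neg, sub_eq_add_neg, Real.exp_add, Real.exp_add]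
  simp only [neg_mul]
  ring

/-- In the even form of the integral, cosh(vt) grows with |v| pointwise; strictness at t = 1 and
continuity make the integrals differ. -/
theorem besselKIntegral_lt {v w : ℝ} (h : |v| < |w|) {x : ℝ} (hx : 0 < x) :
    besselKIntegral v x < besselKIntegral w x := by
  rw [besselKIntegral_eq_cosh v hx, besselKIntegral_eq_cosh w hx]
  have iv := integrable_cosh_mul_exp_neg v hx
  have iw := integrable_cosh_mul_exp_neg w hx
  have hpos : 0 < ∫ t : ℝ, (Real.cosh (w * t) * Real.exp (-(x * Real.cosh t)) -
      Real.cosh (v * t) * Real.exp (-(x * Real.cosh t))) := by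
    refine MeasureTheory.integral_pos_of_integrable_nonneg_nonzero (x := 1) (by fun_prop)
      (iw.sub iv) (fun t => ?_) ?_
    · have : Real.cosh (v * t) ≤ Real.cosh (w * t) := by
        rw [Real.cosh_le_cosh, abs_mul, abs_mul]
        gcongr
      simp only [Pi.zero_apply, sub_nonneg]
      gcongr
    · have : Real.cosh (v * 1) < Real.cosh (w * 1) := by
        rw [Real.cosh_lt_cosh]; simpa using h
      have h2 := mul_lt_mul_of_pos_right this (Real.exp_pos (-(x * Real.cosh 1)))
      exact (sub_pos.2 h2).ne'
  rw [MeasureTheory.integral_sub iw iv] at hpos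
  linarith

theorem besselKIntegral_le_exp (v : ℝ) {x : ℝ} (hx : 1 ≤ x) :
    besselKIntegral v x ≤ besselKIntegral v 1 * Real.exp (1 - x) := by
  unfold besselKIntegral
  rw [div_mul_eq_mul_div, ← MeasureTheory.integral_mul_const]
  refine div_le_div_of_nonneg_right ?_ zero_le_two
  refine MeasureTheory.integral_mono (integrable_exp_sub_cosh v (by linarith))
    ((integrable_exp_sub_cosh v one_pos).mul_const _) fun t => ?_
  simp only
  rw [← Real.exp_add, Real.exp_le_exp]
  nlinarith [Real.one_le_cosh t]

theorem tendsto_besselKIntegral_order (v : ℝ) {x : ℝ} (hx : 0 < x) :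
    Tendsto (fun u => besselKIntegral u x) (𝓝 v) (𝓝 (besselKIntegral v x)) := by
  unfold besselKIntegral
  refine Tendsto.div_const ?_ 2
  -- For orders within 1 of v, the integrand is at most the one of order v + 1 (t ≥ 0) or v - 1 (t ≤
  -- 0), hence at most their sum.
  refine MeasureTheory.tendsto_integral_filter_of_dominated_convergence
    (fun t => Real.exp ((v + 1) * t - x * Real.cosh t) +
      Real.exp ((v - 1) * t - x * Real.cosh t))
    (Eventually.of_forall fun u => by fun_prop) ?_
    ((integrable_exp_sub_cosh _ hx).add (integrable_exp_sub_cosh _ hx)) ?_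
  · filter_upwards [Ioo_mem_nhds (show v - 1 < v by linarith) (show v < v + 1 by linarith)]
      with u hu
    refine Eventually.of_forall fun t => ?_
    rw [Real.norm_eq_abs, Real.abs_exp]
    rcases le_total 0 t with ht | ht
    · have : Real.exp (u * t - x * Real.cosh t) ≤ Real.exp ((v + 1) * t - x * Real.cosh t) := by
        rw [Real.exp_le_exp]; nlinarith [hu.2]
      linarith [Real.exp_pos ((v - 1) * t - x * Real.cosh t)]
    · have : Real.exp (u * t - x * Real.cosh t) ≤ Real.exp ((v - 1) * t - x * Real.cosh t) := by
        rw [Real.exp_le_exp]; nlinarith [hu.1]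
      linarith [Real.exp_pos ((v + 1) * t - x * Real.cosh t)]
  · refine Eventually.of_forall fun t => ?_
    have : Continuous fun u : ℝ => Real.exp (u * t - x * Real.cosh t) := by fun_prop
    exact this.tendsto v

/-! ### Behaviour of the integral at the origin -/

theorem integral_exp_mul_sub_exp {v : ℝ} (hv : 0 < v) :
    ∫ t : ℝ, Real.exp (v * t - Real.exp t / 2) = 2 ^ v * Real.Gamma v := by
  have h := MeasureTheory.integral_image_eq_integral_abs_deriv_smul (s := Set.univ)
    (f := Real.exp) (f' := Real.exp) MeasurableSet.univ
    (fun t _ => (Real.hasDerivAt_exp t).hasDerivWithinAt) Real.exp_injective.injOn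
    (fun u => u ^ (v - 1) * Real.exp (-(1 / 2 * u)))
  rw [Set.image_univ, Real.range_exp, Real.integral_rpow_mul_exp_neg_mul_Ioi hv (by norm_num),
    MeasureTheory.setIntegral_univ] at h
  norm_num at h
  rw [h]
  congr 1
  ext t
  rw [← Real.exp_mul, ← Real.exp_add, ← Real.exp_add]
  congr 1
  ring

theorem integrable_exp_mul_sub_exp {v : ℝ} (hv : 0 < v) :
    MeasureTheory.Integrable (fun t : ℝ => Real.exp (v * t - Real.exp t / 2)) := by
  -- A non-integrable function has integral 0 by convention, but the value computed above is
  -- positive.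
  by_contra h
  have h1 := integral_exp_mul_sub_exp hv
  rw [MeasureTheory.integral_undef h] at h1
  have := Real.Gamma_pos_of_pos hv
  have h2 : 0 < (2 : ℝ) ^ v * Real.Gamma v := by positivity
  linarith

/-- Translating t by -log x absorbs the factor x^v and confines x to a term that disappears as x →
0. -/
theorem rpow_mul_besselKIntegral (v : ℝ) {x : ℝ} (hx : 0 < x) :
    x ^ v * besselKIntegral v x =
      (∫ t : ℝ, Real.exp (v * t - Real.exp t / 2 - x ^ 2 * (Real.exp (-t) / 2))) / 2 := by
  unfold besselKIntegral
  rw [← MeasureTheory.integral_add_right_eq_self _ (-Real.log x), ← mul_div_assoc,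
    ← MeasureTheory.integral_const_mul]
  congr 2
  ext t
  rw [Real.rpow_def_of_pos hx, ← Real.exp_add, Real.cosh_eq, neg_add, neg_neg, Real.exp_add t,
    Real.exp_add (-t), Real.exp_neg (Real.log x), Real.exp_log hx]
  congr 1
  field_simp
  ring

theorem tendsto_rpow_mul_besselKIntegral {v : ℝ} (hv : 0 < v) :
    Tendsto (fun x => x ^ v * besselKIntegral v x) (𝓝[>] 0)
      (𝓝 (2 ^ v * Real.Gamma v / 2)) := by
  have : Tendsto (fun x : ℝ => (∫ t : ℝ, Real.exp (v * t - Real.exp t / 2 -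
      x ^ 2 * (Real.exp (-t) / 2))) / 2) (𝓝[>] 0) (𝓝 (2 ^ v * Real.Gamma v / 2)) := by
    rw [← integral_exp_mul_sub_exp hv]
    refine Tendsto.div_const ?_ 2
    refine MeasureTheory.tendsto_integral_filter_of_dominated_convergence
      (fun t => Real.exp (v * t - Real.exp t / 2)) (Eventually.of_forall fun u => by fun_prop)
      ?_ (integrable_exp_mul_sub_exp hv) ?_
    · refine Eventually.of_forall fun x => Eventually.of_forall fun t => ?_
      rw [Real.norm_eq_abs, Real.abs_exp, Real.exp_le_exp]
      have : 0 ≤ x ^ 2 * (Real.exp (-t) / 2) := by positivity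
      linarith
    · refine Eventually.of_forall fun t => ?_
      have : Continuous fun x : ℝ =>
        Real.exp (v * t - Real.exp t / 2 - x ^ 2 * (Real.exp (-t) / 2)) := by fun_prop
      simpa using (this.tendsto 0).mono_left (nhdsWithin_le_nhds (s := Set.Ioi 0))
  refine this.congr' ?_
  filter_upwards [self_mem_nhdsWithin] with x hx
  exact (rpow_mul_besselKIntegral v hx).symm

/-! ### Series for I_v and recurrences for the quotient -/

/-- The entire series `∑ zⁿ / (n! Γ(v+n+1))`. -/
noncomputable def besselSeries (v z : ℝ) : ℝ :=
  ∑' n : ℕ, z ^ n / ((n.factorial : ℝ) * Real.Gamma (v + n + 1))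

theorem summable_besselSeries (v z : ℝ) :
    Summable fun n : ℕ => z ^ n / ((n.factorial : ℝ) * Real.Gamma (v + n + 1)) := by
  refine Summable.of_norm_bounded_eventually_nat (Real.summable_pow_div_factorial |z|) ?_
  -- From this index on the Gamma argument is at least 2, so Gamma ≥ 1 and the exponential series
  -- dominates.
  filter_upwards [eventually_ge_atTop ⌈1 - v⌉₊] with n hn
  have hn' : 1 - v ≤ n := Nat.ceil_le.1 hn
  have hG : 1 ≤ Real.Gamma (v + n + 1) := by
    have := Real.Gamma_strictMonoOn_Ici.monotoneOn (Set.mem_Ici.2 le_rfl)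
      (Set.mem_Ici.2 (by linarith : 2 ≤ v + n + 1)) (by linarith)
    rwa [Real.Gamma_two] at this
  have hf : (0 : ℝ) < n.factorial := by exact_mod_cast n.factorial_pos
  rw [norm_div, norm_pow, Real.norm_eq_abs, Real.norm_eq_abs,
    abs_of_pos (by positivity : 0 < (n.factorial : ℝ) * Real.Gamma (v + n + 1))]
  gcongr
  nlinarith

theorem succ_mul_besselSeries_coeff (v : ℝ) (n : ℕ) :
    ((n + 1 : ℕ) : ℝ) / (((n + 1).factorial : ℝ) * Real.Gamma (v + (n + 1 : ℕ) + 1)) =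
      1 / ((n.factorial : ℝ) * Real.Gamma (v + 1 + n + 1)) := by
  have hf : (n.factorial : ℝ) ≠ 0 := by exact_mod_cast n.factorial_ne_zero
  have hn : ((n + 1 : ℕ) : ℝ) ≠ 0 := by exact_mod_cast n.succ_ne_zero
  rw [show v + ((n + 1 : ℕ) : ℝ) + 1 = v + 1 + n + 1 by push_cast; ring, Nat.factorial_succ,
    Nat.cast_mul, mul_assoc, div_mul_eq_div_div, div_self hn]

theorem hasDerivAt_besselSeries (v z : ℝ) :
    HasDerivAt (besselSeries v) (besselSeries (v + 1) z) z := by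
  have shift : ∀ (y : ℝ) (n : ℕ), ((n + 1 : ℕ) : ℝ) * y ^ (n + 1 - 1) /
      (((n + 1).factorial : ℝ) * Real.Gamma (v + (n + 1 : ℕ) + 1)) =
      y ^ n / ((n.factorial : ℝ) * Real.Gamma (v + 1 + n + 1)) := by
    intro y n
    rw [Nat.add_sub_cancel, mul_div_right_comm, succ_mul_besselSeries_coeff]
    ring
  have hs : ∀ y : ℝ, Summable fun n : ℕ => (n : ℝ) * y ^ (n - 1) /
      ((n.factorial : ℝ) * Real.Gamma (v + n + 1)) := by
    intro y
    rw [← summable_nat_add_iff 1]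
    refine (summable_besselSeries (v + 1) y).congr fun n => (shift y n).symm
  have key := hasDerivAt_tsum_of_isPreconnected (𝕜 := ℝ)
    (g := fun (n : ℕ) (z : ℝ) => z ^ n / ((n.factorial : ℝ) * Real.Gamma (v + n + 1)))
    (g' := fun (n : ℕ) (z : ℝ) => (n : ℝ) * z ^ (n - 1) /
      ((n.factorial : ℝ) * Real.Gamma (v + n + 1)))
    (hs (|z| + 1)).norm (t := Metric.ball 0 (|z| + 1)) Metric.isOpen_ball
    (convex_ball _ _).isPreconnected
    (fun n y _ => (hasDerivAt_pow n y).div_const _) ?_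
    (y₀ := z) (by simp) (summable_besselSeries v z) (y := z) (by simp)
  · refine key.congr_deriv ?_
    rw [(hs z).tsum_eq_zero_add]
    simp only [Nat.cast_zero, zero_mul, zero_div, zero_add]
    exact tsum_congr fun n => shift z n
  · intro n y hy
    simp only [norm_div, norm_mul, norm_pow]
    have h1 : ‖y‖ ≤ ‖|z| + 1‖ := by
      rw [Real.norm_eq_abs (|z| + 1), abs_of_nonneg (by positivity)]
      exact (mem_ball_zero_iff.1 hy).le
    gcongr

/-- At the poles the conventions Γ = 0 and 1/0 = 0 reproduce the zeros of the entire function 1/Γ,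
so no order has to be excluded from the recurrences. -/
theorem Real.one_div_Gamma_eq_self_mul (s : ℝ) : 1 / Real.Gamma s = s / Real.Gamma (s + 1) := by
  rcases eq_or_ne s 0 with rfl | hs
  · simp
  · rw [Real.Gamma_add_one hs, div_mul_eq_div_div, div_self hs]

theorem besselSeries_recurrence (v z : ℝ) :
    besselSeries (v - 1) z = v * besselSeries v z + z * besselSeries (v + 1) z := by
  have h1 := summable_besselSeries v z
  have hz : z * besselSeries (v + 1) z = ∑' n : ℕ, (n : ℝ) * (z ^ n /
      ((n.factorial : ℝ) * Real.Gamma (v + n + 1))) := by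
    have hsh : ∀ n : ℕ, ((n + 1 : ℕ) : ℝ) * (z ^ (n + 1) /
      (((n + 1).factorial : ℝ) * Real.Gamma (v + (n + 1 : ℕ) + 1))) =
      z * (z ^ n / ((n.factorial : ℝ) * Real.Gamma (v + 1 + n + 1))) := by
      intro n
      rw [mul_div_left_comm, succ_mul_besselSeries_coeff]
      ring
    have hs : Summable fun n : ℕ => (n : ℝ) * (z ^ n /
        ((n.factorial : ℝ) * Real.Gamma (v + n + 1))) := by
      rw [← summable_nat_add_iff 1]
      exact ((summable_besselSeries (v + 1) z).mul_left z).congr fun n => (hsh n).symm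
    rw [hs.tsum_eq_zero_add]
    simp only [Nat.cast_zero, zero_mul, zero_add]
    rw [besselSeries, ← tsum_mul_left]
    exact tsum_congr fun n => (hsh n).symm
  have h2 : Summable fun n : ℕ => (n : ℝ) * (z ^ n /
        ((n.factorial : ℝ) * Real.Gamma (v + n + 1))) := by
    have := (summable_besselSeries (v - 1) z).sub (h1.mul_left v)
    refine this.congr fun n => ?_
    have hg := Real.one_div_Gamma_eq_self_mul (v + n)
    rw [show v - 1 + (n : ℝ) + 1 = v + n by ring, div_mul_eq_div_mul_one_div, hg]
    field_simp
    ring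
  rw [hz, besselSeries, besselSeries, ← tsum_mul_left, ← (h1.mul_left v).tsum_add h2]
  refine tsum_congr fun n => ?_
  have hg := Real.one_div_Gamma_eq_self_mul (v + n)
  rw [show v - 1 + (n : ℝ) + 1 = v + n by ring, div_mul_eq_div_mul_one_div, hg]
  field_simp

theorem besselI_eq_besselSeries (v : ℝ) {x : ℝ} (hx : 0 < x) :
    besselI v x = (x / 2) ^ v * besselSeries v ((x / 2) ^ 2) := by
  have h2 : 0 < x / 2 := by positivity
  rw [besselI, besselSeries, ← tsum_mul_left]
  refine tsum_congr fun n => ?_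
  rw [Real.rpow_add h2, ← pow_mul, ← Real.rpow_natCast (x / 2) (2 * n)]
  push_cast
  ring

theorem hasDerivAt_besselI_aux (v : ℝ) {x : ℝ} (hx : 0 < x) :
    HasDerivAt (besselI v) (v / x * besselI v x + besselI (v + 1) x) x := by
  have h2 : 0 < x / 2 := by positivity
  have hd : HasDerivAt (fun x : ℝ => x / 2) (1 / 2) x := (hasDerivAt_id x).div_const 2
  have h := (hd.rpow_const (p := v) (Or.inl h2.ne')).mul
    ((hasDerivAt_besselSeries v ((x / 2) ^ 2)).comp x (hd.pow 2))
  refine (h.congr_deriv ?_).congr_of_eventuallyEq ?_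
  · rw [besselI_eq_besselSeries v hx, besselI_eq_besselSeries (v + 1) hx, Real.rpow_add_one h2.ne',
      Real.rpow_sub_one h2.ne']
    simp only [Function.comp, Pi.pow_apply]
    generalize besselSeries v ((x / 2) ^ 2) = a
    generalize besselSeries (v + 1) ((x / 2) ^ 2) = b
    field_simp
    norm_num
    ring
  · filter_upwards [Ioi_mem_nhds hx] with y hy
    exact besselI_eq_besselSeries v hy

theorem besselI_recurrence (v : ℝ) {x : ℝ} (hx : 0 < x) :
    besselI (v - 1) x = 2 * v / x * besselI v x + besselI (v + 1) x := by
  have h2 : 0 < x / 2 := by positivity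
  rw [besselI_eq_besselSeries v hx, besselI_eq_besselSeries (v + 1) hx,
    besselI_eq_besselSeries (v - 1) hx, Real.rpow_add_one h2.ne',
      Real.rpow_sub_one h2.ne', besselSeries_recurrence]
  field_simp

theorem hasDerivAt_besselKQuot (v : ℝ) {x : ℝ} (hx : 0 < x) :
    HasDerivAt (besselKQuot v) (v / x * besselKQuot v x - besselKQuot (v + 1) x) x := by
  have h := (((hasDerivAt_besselI_aux (-v) hx).sub (hasDerivAt_besselI_aux v hx)).div_const
    (Real.sin (v * Real.pi))).const_mul (Real.pi / 2)
  refine h.congr_deriv ?_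
  have hr := besselI_recurrence (-v) hx
  have hs : Real.sin ((v + 1) * Real.pi) = -Real.sin (v * Real.pi) := by
    rw [add_mul, one_mul, Real.sin_add_pi]
  simp only [besselKQuot, hs, show -(v + 1) = -v - 1 by ring, hr]
  ring

theorem besselKQuot_neg (v x : ℝ) : besselKQuot (-v) x = besselKQuot v x := by
  simp only [besselKQuot, neg_neg, neg_mul, Real.sin_neg, div_neg]
  ring

theorem hasDerivAt_besselKQuot' (v : ℝ) {x : ℝ} (hx : 0 < x) :
    HasDerivAt (besselKQuot v) (-(v / x * besselKQuot v x) - besselKQuot (1 - v) x) x := by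
  have h := hasDerivAt_besselKQuot (-v) hx
  have e : besselKQuot (-v) = besselKQuot v := funext fun y => besselKQuot_neg v y
  rw [e, show -v + 1 = 1 - v by ring, neg_div, neg_mul] at h
  exact h

/-! ### The integral equals the quotient -/

/-- The term I_{-v} dominates, I_v being smaller by x^{2v}; the reflection formula turns its
constant into the one found for the integral. -/
theorem tendsto_rpow_mul_besselKQuot {v : ℝ} (hv : 0 < v) (hv1 : v < 1) :
    Tendsto (fun x => x ^ v * besselKQuot v x) (𝓝[>] 0) (𝓝 (2 ^ v * Real.Gamma v / 2)) := by
  have hs : 0 < Real.sin (Real.pi * v) :=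
    Real.sin_pos_of_pos_of_lt_pi (by positivity) (by nlinarith [Real.pi_pos])
  have hG := Real.Gamma_pos_of_pos (show 0 < 1 - v by linarith)
  have hG2 := Real.Gamma_mul_Gamma_one_sub v
  have hc : ∀ w : ℝ, Tendsto (fun x : ℝ => besselSeries w ((x / 2) ^ 2)) (𝓝[>] 0)
      (𝓝 (1 / Real.Gamma (w + 1))) := by
    intro w
    have h0 : besselSeries w 0 = 1 / Real.Gamma (w + 1) := by
      rw [besselSeries, tsum_eq_single 0]
      · simp
      · intro n hn; simp [hn]
    have hcont : Continuous (besselSeries w) :=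
      continuous_iff_continuousAt.2 fun z => (hasDerivAt_besselSeries w z).continuousAt
    have : Continuous fun x : ℝ => besselSeries w ((x / 2) ^ 2) := by fun_prop
    have h := (this.tendsto 0).mono_left (nhdsWithin_le_nhds (s := Set.Ioi 0))
    simpa [h0] using h
  have hp : Tendsto (fun x : ℝ => x ^ (2 * v)) (𝓝[>] 0) (𝓝 0) := by
    have := (Real.continuousAt_rpow_const 0 (2 * v) (Or.inr (by positivity))).tendsto
    rw [Real.zero_rpow (by positivity)] at this
    exact this.mono_left nhdsWithin_le_nhds
  have hlim := ((((hc (-v)).const_mul ((2 : ℝ) ^ v)).sub ((hp.mul (hc v)).const_mul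
    ((2 : ℝ) ^ (-v)))).div_const (Real.sin (v * Real.pi))).const_mul (Real.pi / 2)
  have e : Real.pi / 2 * ((2 ^ v * (1 / Real.Gamma (-v + 1)) -
      2 ^ (-v) * (0 * (1 / Real.Gamma (v + 1)))) / Real.sin (v * Real.pi)) =
      2 ^ v * Real.Gamma v / 2 := by
    rw [show -v + 1 = 1 - v by ring, mul_comm v Real.pi, zero_mul, mul_zero, sub_zero]
    rw [eq_div_iff hs.ne'] at hG2
    field_simp
    linear_combination -hG2
  rw [e] at hlim
  refine hlim.congr' ?_
  filter_upwards [self_mem_nhdsWithin] with x hx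
  have hx : 0 < x := hx
  rw [besselKQuot, besselI_eq_besselSeries v hx, besselI_eq_besselSeries (-v) hx,
    Real.div_rpow hx.le zero_le_two, Real.div_rpow hx.le zero_le_two, two_mul, Real.rpow_add hx,
    Real.rpow_neg zero_le_two, Real.rpow_neg hx.le]
  have h1 := Real.rpow_pos_of_pos hx v
  have h2 := Real.rpow_pos_of_pos (zero_lt_two (α := ℝ)) v
  field_simp

/-- With p and q the differences at orders v and 1 - v, weighted by x^v and x^{1-v}, one has p' =
-x^{2v-1} q and q' = -x^{1-2v} p, and both vanish at 0. An energy estimate then forces p = q = 0. -/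
theorem besselKIntegral_eq_besselKQuot_of_lt_one {v : ℝ} (hv : 0 < v) (hv1 : v < 1) {x : ℝ}
    (hx : 0 < x) : besselKIntegral v x = besselKQuot v x := by
  have hp : ∀ w y : ℝ, 0 < y →
      HasDerivAt (fun y => y ^ w * (besselKIntegral w y - besselKQuot w y))
        (-(y ^ w * (besselKIntegral (1 - w) y - besselKQuot (1 - w) y))) y := by
    intro w y hy
    have h := (Real.hasDerivAt_rpow_const (p := w) (Or.inl hy.ne')).mul
      ((hasDerivAt_besselKIntegral' w hy).sub (hasDerivAt_besselKQuot' w hy))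
    refine h.congr_deriv ?_
    rw [show 1 - w = -(w - 1) by ring, besselKIntegral_neg, Real.rpow_sub_one hy.ne',
      Pi.sub_apply]
    field_simp
    ring
  have hl : ∀ w : ℝ, 0 < w → w < 1 →
      Tendsto (fun y => y ^ w * (besselKIntegral w y - besselKQuot w y)) (𝓝[>] 0) (𝓝 0) := by
    intro w hw hw1
    have := (tendsto_rpow_mul_besselKIntegral hw).sub (tendsto_rpow_mul_besselKQuot hw hw1)
    rw [sub_self] at this
    exact this.congr fun y => by ring
  set p : ℝ → ℝ := fun y => y ^ v * (besselKIntegral v y - besselKQuot v y) with hpdef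
  set q : ℝ → ℝ := fun y => y ^ (1 - v) * (besselKIntegral (1 - v) y - besselKQuot (1 - v) y)
    with hqdef
  have hp' : ∀ y : ℝ, 0 < y → HasDerivAt p (-(y ^ (2 * v - 1) * q y)) y := by
    intro y hy
    refine (hp v y hy).congr_deriv ?_
    simp only [hqdef]
    rw [← mul_assoc, ← Real.rpow_add hy, show 2 * v - 1 + (1 - v) = v by ring]
  have hq' : ∀ y : ℝ, 0 < y → HasDerivAt q (-(y ^ (1 - 2 * v) * p y)) y := by
    intro y hy
    refine (hp (1 - v) y hy).congr_deriv ?_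
    simp only [hpdef]
    rw [← mul_assoc, ← Real.rpow_add hy, show 1 - 2 * v + v = 1 - v by ring, sub_sub_cancel]
  -- A primitive of the sum of the two coefficients: with the weight exp(-φ), the derivative of the
  -- energy becomes minus a multiple of (p + q)².
  set φ : ℝ → ℝ := fun y => y ^ (2 * v) / (2 * v) + y ^ (2 - 2 * v) / (2 - 2 * v) with hφdef
  have hφ : ∀ y : ℝ, 0 < y → HasDerivAt φ (y ^ (2 * v - 1) + y ^ (1 - 2 * v)) y := by
    intro y hy
    have h2 : 2 - 2 * v ≠ 0 := by linarith
    refine (((Real.hasDerivAt_rpow_const (p := 2 * v) (Or.inl hy.ne')).div_const (2 * v)).add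
      ((Real.hasDerivAt_rpow_const (p := 2 - 2 * v) (Or.inl hy.ne')).div_const
        (2 - 2 * v))).congr_deriv ?_
    rw [show 2 - 2 * v - 1 = 1 - 2 * v by ring, mul_div_cancel_left₀ _ (by positivity),
      mul_div_cancel_left₀ _ h2]
  have hE : ∀ y : ℝ, 0 < y → HasDerivAt (fun y => (p y ^ 2 + q y ^ 2) * Real.exp (-φ y))
      (-((y ^ (2 * v - 1) + y ^ (1 - 2 * v)) * (p y + q y) ^ 2 * Real.exp (-φ y))) y := by
    intro y hy
    refine ((((hp' y hy).pow 2).add ((hq' y hy).pow 2)).mul (hφ y hy).neg.exp).congr_deriv ?_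
    simp only [Pi.add_apply, Pi.pow_apply, Pi.neg_apply]
    norm_num
    ring
  have hanti : AntitoneOn (fun y => (p y ^ 2 + q y ^ 2) * Real.exp (-φ y)) (Set.Ioi 0) := by
    refine antitoneOn_of_deriv_nonpos (convex_Ioi 0)
      (fun y hy => (hE y hy).continuousAt.continuousWithinAt)
      (fun y hy => (hE y (interior_subset hy)).differentiableAt.differentiableWithinAt)
      fun y hy => ?_
    have hy : 0 < y := interior_subset hy
    rw [(hE y hy).deriv]
    have : 0 ≤ (y ^ (2 * v - 1) + y ^ (1 - 2 * v)) * (p y + q y) ^ 2 * Real.exp (-φ y) := by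
      positivity
    linarith
  have hlim : Tendsto (fun y => p y ^ 2 + q y ^ 2) (𝓝[>] 0) (𝓝 0) := by
    simpa using ((hl v hv hv1).pow 2).add ((hl (1 - v) (by linarith) (by linarith)).pow 2)
  have hle : (p x ^ 2 + q x ^ 2) * Real.exp (-φ x) ≤ 0 := by
    refine ge_of_tendsto hlim ?_
    filter_upwards [Ioo_mem_nhdsGT hx] with y hy
    refine (hanti hy.1 hx hy.2.le).trans ?_
    have hy0 : 0 < y := hy.1
    have h1 : 0 ≤ φ y := by
      have h2 : 0 < 2 - 2 * v := by linarith
      simp only [hφdef]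
      positivity
    exact mul_le_of_le_one_right (by positivity) (Real.exp_le_one_iff.2 (by linarith))
  have h2 : p x ^ 2 + q x ^ 2 ≤ 0 := nonpos_of_mul_nonpos_left hle (Real.exp_pos _)
  have h3 : p x = 0 := by nlinarith [sq_nonneg (p x), sq_nonneg (q x)]
  have h4 : x ^ v ≠ 0 := (Real.rpow_pos_of_pos hx v).ne'
  exact sub_eq_zero.1 ((mul_eq_zero.1 h3).resolve_left h4)

/-- Both families satisfy K_{v+1} = (v/x) K_v - K_v', so equality at one order on the half-line
passes to the next. -/
theorem besselKIntegral_eq_besselKQuot_add_nat {v : ℝ} (hv : 0 < v) (hv1 : v < 1) (n : ℕ) :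
    ∀ x : ℝ, 0 < x → besselKIntegral (v + n) x = besselKQuot (v + n) x := by
  induction n with
  | zero =>
    intro x hx
    simpa using besselKIntegral_eq_besselKQuot_of_lt_one hv hv1 hx
  | succ n ih =>
    intro x hx
    have h := (hasDerivAt_besselKQuot (v + n) hx).congr_of_eventuallyEq
      (f₁ := besselKIntegral (v + n)) (by
        filter_upwards [Ioi_mem_nhds hx] with y hy
        exact ih y hy)
    have h2 := h.unique (hasDerivAt_besselKIntegral (v + n) hx)
    rw [ih x hx] at h2
    push_cast
    rw [← add_assoc]
    linarith

theorem besselKIntegral_eq_besselKQuot {v : ℝ} (hv : ¬ ∃ n : ℤ, v = n) {x : ℝ} (hx : 0 < x) :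
    besselKIntegral v x = besselKQuot v x := by
  have pos : ∀ w : ℝ, 0 ≤ w → (¬ ∃ n : ℤ, w = n) →
      besselKIntegral w x = besselKQuot w x := by
    intro w hw hn
    have h0 : 0 < Int.fract w := by
      refine lt_of_le_of_ne (Int.fract_nonneg w) fun h => hn ⟨⌊w⌋, ?_⟩
      have := Int.floor_add_fract w
      rw [← h, add_zero] at this
      exact this.symm
    have h := besselKIntegral_eq_besselKQuot_add_nat h0 (Int.fract_lt_one w) ⌊w⌋₊ x hx
    have e : Int.fract w + (⌊w⌋₊ : ℝ) = w := by
      rw [natCast_floor_eq_intCast_floor hw, Int.fract_add_floor]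
    rwa [e] at h
  rcases le_total 0 v with h | h
  · exact pos v h hv
  · rw [← besselKIntegral_neg, ← besselKQuot_neg]
    refine pos (-v) (by linarith) fun ⟨n, hn⟩ => hv ⟨-n, ?_⟩
    push_cast
    linarith

theorem besselK_eq_besselKIntegral (v : ℝ) {x : ℝ} (hx : 0 < x) :
    besselK v x = besselKIntegral v x := by
  unfold besselK
  split_ifs with hv
  · obtain ⟨n, rfl⟩ := hv
    refine Tendsto.limUnder_eq ?_
    refine ((tendsto_besselKIntegral_order (n : ℝ) hx).mono_left nhdsWithin_le_nhds).congr' ?_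
    -- This punctured interval contains no integer, so the quotient agrees with the integral there.
    have hmem : Set.Ioo ((n : ℝ) - 1) (n + 1) ∈ 𝓝[≠] (n : ℝ) :=
      nhdsWithin_le_nhds (Ioo_mem_nhds (by linarith) (by linarith))
    filter_upwards [hmem, self_mem_nhdsWithin] with u hu hne
    refine besselKIntegral_eq_besselKQuot (fun ⟨m, hm⟩ => hne ?_) hx
    subst hm
    have h1 : n - 1 < m := by exact_mod_cast hu.1
    have h2 : m < n + 1 := by exact_mod_cast hu.2
    have : m = n := by omega
    simp [this]
  · exact (besselKIntegral_eq_besselKQuot hv hx).symm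

/-! ### Decay at infinity and signs from monotone convergence to zero -/

theorem tendsto_pow_mul_besselKIntegral_atTop (v : ℝ) (n : ℕ) :
    Tendsto (fun x : ℝ => x ^ n * besselKIntegral v x) atTop (𝓝 0) := by
  have h := (Real.tendsto_pow_mul_exp_neg_atTop_nhds_zero n).const_mul
    (besselKIntegral v 1 * Real.exp 1)
  rw [mul_zero] at h
  refine squeeze_zero' ?_ ?_ h
  · filter_upwards [eventually_gt_atTop 0] with x hx
    have := besselKIntegral_pos v hx
    positivity
  · filter_upwards [eventually_ge_atTop 1] with x hx
    have h1 := besselKIntegral_le_exp v hx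
    rw [sub_eq_add_neg, Real.exp_add] at h1
    have := mul_le_mul_of_nonneg_left h1 (show 0 ≤ x ^ n by positivity)
    linarith

theorem neg_of_hasDerivAt_pos_of_tendsto_zero {f f' : ℝ → ℝ}
    (hd : ∀ x, 0 < x → HasDerivAt f (f' x) x) (hf' : ∀ x, 0 < x → 0 < f' x)
    (hf : Tendsto f atTop (𝓝 0)) {x : ℝ} (hx : 0 < x) : f x < 0 := by
  have hm : StrictMonoOn f (Set.Ioi 0) := by
    refine strictMonoOn_of_deriv_pos (convex_Ioi 0)
      (fun y hy => (hd y hy).continuousAt.continuousWithinAt) fun y hy => ?_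
    rw [(hd y (interior_subset hy)).deriv]
    exact hf' y (interior_subset hy)
  -- The intermediate point x + 1 keeps the inequality strict after passage to the limit.
  have h1 : f x < f (x + 1) := hm hx (by simp; linarith) (by linarith)
  refine h1.trans_le (ge_of_tendsto hf ?_)
  filter_upwards [eventually_ge_atTop (x + 1)] with y hy
  exact hm.monotoneOn (by simp; linarith) (by simp; linarith) hy

theorem pos_of_hasDerivAt_neg_of_tendsto_zero {f f' : ℝ → ℝ}
    (hd : ∀ x, 0 < x → HasDerivAt f (f' x) x) (hf' : ∀ x, 0 < x → f' x < 0)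
    (hf : Tendsto f atTop (𝓝 0)) {x : ℝ} (hx : 0 < x) : 0 < f x := by
  have := neg_of_hasDerivAt_pos_of_tendsto_zero (f := fun x => -f x)
    (fun y hy => (hd y hy).fun_neg) (fun y hy => neg_pos.2 (hf' y hy)) (by simpa using hf.neg) hx
  linarith

/-! ### Bounds and monotonicity of the slope -/

theorem hasDerivAt_besselKIntegral_succ (v : ℝ) {x : ℝ} (hx : 0 < x) :
    HasDerivAt (besselKIntegral (v + 1))
      (-((v + 1) / x * besselKIntegral (v + 1) x) - besselKIntegral v x) x := by
  simpa using hasDerivAt_besselKIntegral' (v + 1) hx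

theorem hasDerivAt_besselKIntegral_half {x : ℝ} (hx : 0 < x) :
    HasDerivAt (besselKIntegral (1 / 2))
      (-((1 + 1 / (2 * x)) * besselKIntegral (1 / 2) x)) x := by
  refine (hasDerivAt_besselKIntegral' (1 / 2) hx).congr_deriv ?_
  rw [show (1 / 2 : ℝ) - 1 = -(1 / 2) by norm_num, besselKIntegral_neg]
  field_simp
  ring

/-- The logarithmic derivative `x + x K_v'(x) / K_v(x)` of `e^x K_v(x)` with respect to
`log x`. -/
noncomputable def besselKSlope (v x : ℝ) : ℝ :=
  x + v - x * besselKIntegral (v + 1) x / besselKIntegral v x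

theorem hasDerivAt_rpow_mul_exp_mul_besselKIntegral (v r : ℝ) {x : ℝ} (hx : 0 < x) :
    HasDerivAt (fun x => x ^ r * Real.exp x * besselKIntegral v x)
      (x ^ (r - 1) * Real.exp x * besselKIntegral v x * (r + besselKSlope v x)) x := by
  refine (((Real.hasDerivAt_rpow_const (p := r) (Or.inl hx.ne')).mul (Real.hasDerivAt_exp x)).mul
    (hasDerivAt_besselKIntegral v hx)).congr_deriv ?_
  have hK := (besselKIntegral_pos v hx).ne'
  simp only [besselKSlope, Real.rpow_sub_one hx.ne', Pi.mul_apply]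
  field_simp
  ring

theorem hasDerivAt_besselKSlope (v : ℝ) {x : ℝ} (hx : 0 < x) :
    HasDerivAt (besselKSlope v)
      (((x + 1) * besselKIntegral v x ^ 2 +
        2 * v * besselKIntegral v x * besselKIntegral (v + 1) x -
        x * besselKIntegral (v + 1) x ^ 2) / besselKIntegral v x ^ 2) x := by
  have hK := (besselKIntegral_pos v hx).ne'
  have h := ((hasDerivAt_id x).add_const v).sub (((hasDerivAt_id x).mul
    (hasDerivAt_besselKIntegral_succ v hx)).div (hasDerivAt_besselKIntegral v hx) hK)
  refine h.congr_deriv ?_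
  simp only [Pi.mul_apply, id]
  field_simp
  ring

/-- Up to a positive factor, the Wronskian of `K_v` and `K_{1/2}`. -/
theorem hasDerivAt_wronskian_half (v : ℝ) {x : ℝ} (hx : 0 < x) :
    HasDerivAt (fun x => besselKIntegral (1 / 2) x * ((v + x + 1 / 2) * besselKIntegral v x -
        x * besselKIntegral (v + 1) x))
      ((v ^ 2 - 1 / 4) * (besselKIntegral v x * besselKIntegral (1 / 2) x / x)) x := by
  have h := (hasDerivAt_besselKIntegral_half hx).mul
    (((((hasDerivAt_id x).const_add v).add_const (1 / 2)).mul
      (hasDerivAt_besselKIntegral v hx)).sub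
      ((hasDerivAt_id x).mul (hasDerivAt_besselKIntegral_succ v hx)))
  refine h.congr_deriv ?_
  simp only [Pi.mul_apply, Pi.sub_apply, id]
  field_simp
  ring

theorem tendsto_wronskian_half (v : ℝ) :
    Tendsto (fun x => besselKIntegral (1 / 2) x * ((v + x + 1 / 2) * besselKIntegral v x -
        x * besselKIntegral (v + 1) x)) atTop (𝓝 0) := by
  have h0 := tendsto_pow_mul_besselKIntegral_atTop (1 / 2) 0
  have h1 := tendsto_pow_mul_besselKIntegral_atTop v 0
  have h2 := tendsto_pow_mul_besselKIntegral_atTop v 1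
  have h3 := tendsto_pow_mul_besselKIntegral_atTop (v + 1) 1
  have h := h0.mul (((h1.const_mul (v + 1 / 2)).add h2).sub h3)
  simp only [mul_zero, add_zero, sub_zero] at h
  exact h.congr fun x => by ring

theorem besselKSlope_eq (v : ℝ) {x : ℝ} (hx : 0 < x) :
    besselKSlope v x + 1 / 2 = ((v + x + 1 / 2) * besselKIntegral v x -
        x * besselKIntegral (v + 1) x) / besselKIntegral v x := by
  have hK := (besselKIntegral_pos v hx).ne'
  unfold besselKSlope
  field_simp
  ring

theorem besselKSlope_lt_neg_half {v : ℝ} (hv : 1 / 2 < v) {x : ℝ} (hx : 0 < x) :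
    besselKSlope v x < -(1 / 2) := by
  have h := neg_of_hasDerivAt_pos_of_tendsto_zero (fun y hy => hasDerivAt_wronskian_half v hy)
    (fun y hy => mul_pos (by nlinarith) (by
      have := besselKIntegral_pos v hy
      have := besselKIntegral_pos (1 / 2) hy
      positivity)) (tendsto_wronskian_half v) hx
  have h2 := div_neg_of_neg_of_pos (neg_of_mul_neg_right h (besselKIntegral_pos (1 / 2) hx).le)
    (besselKIntegral_pos v hx)
  rw [← besselKSlope_eq v hx] at h2
  linarith

theorem neg_half_lt_besselKSlope {v : ℝ} (hv0 : 0 ≤ v) (hv : v < 1 / 2) {x : ℝ} (hx : 0 < x) :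
    -(1 / 2) < besselKSlope v x := by
  have h := pos_of_hasDerivAt_neg_of_tendsto_zero (fun y hy => hasDerivAt_wronskian_half v hy)
    (fun y hy => mul_neg_of_neg_of_pos (by nlinarith) (by
      have := besselKIntegral_pos v hy
      have := besselKIntegral_pos (1 / 2) hy
      positivity)) (tendsto_wronskian_half v) hx
  have h2 := div_pos (pos_of_mul_pos_right h (besselKIntegral_pos (1 / 2) hx).le)
    (besselKIntegral_pos v hx)
  rw [← besselKSlope_eq v hx] at h2
  linarith

/-- The sign of h + v becomes that of K_v - K_{v-1}; for v ≥ 0, |v - 1| < v holds exactly when v >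
1/2. -/
theorem besselKSlope_add_order (v : ℝ) {x : ℝ} (hx : 0 < x) :
    besselKSlope v x + v =
      x * (besselKIntegral v x - besselKIntegral (v - 1) x) / besselKIntegral v x := by
  have hK := (besselKIntegral_pos v hx).ne'
  have := besselKIntegral_recurrence v hx
  unfold besselKSlope
  field_simp
  linarith

theorem neg_order_lt_besselKSlope {v : ℝ} (hv : 1 / 2 < v) {x : ℝ} (hx : 0 < x) :
    -v < besselKSlope v x := by
  have h := besselKSlope_add_order v hx
  have h1 : besselKIntegral (v - 1) x < besselKIntegral v x := by
    refine besselKIntegral_lt ?_ hx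
    rw [abs_of_pos (by linarith : 0 < v), abs_lt]
    constructor <;> linarith
  have h2 : 0 < x * (besselKIntegral v x - besselKIntegral (v - 1) x) / besselKIntegral v x :=
    div_pos (mul_pos hx (by linarith)) (besselKIntegral_pos v hx)
  linarith

theorem besselKSlope_lt_neg_order {v : ℝ} (hv0 : 0 ≤ v) (hv : v < 1 / 2) {x : ℝ} (hx : 0 < x) :
    besselKSlope v x < -v := by
  have h := besselKSlope_add_order v hx
  have h1 : besselKIntegral v x < besselKIntegral (v - 1) x := by
    refine besselKIntegral_lt ?_ hx
    rw [abs_of_nonneg hv0, abs_of_neg (by linarith)]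
    linarith
  have h2 : x * (besselKIntegral v x - besselKIntegral (v - 1) x) / besselKIntegral v x < 0 :=
    div_neg_of_neg_of_pos (mul_neg_of_pos_of_neg hx (by linarith)) (besselKIntegral_pos v hx)
  linarith

theorem besselKSlope_half {x : ℝ} (hx : 0 < x) : besselKSlope (1 / 2) x = -(1 / 2) := by
  have h := besselKSlope_add_order (1 / 2) hx
  rw [show (1 / 2 : ℝ) - 1 = -(1 / 2) by norm_num, besselKIntegral_neg, sub_self, mul_zero,
    zero_div] at h
  linarith

/-- The differentiated function is x K_v² h', so the known sign of h + 1/2, with decay at infinity,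
determines the sign of h'. -/
theorem hasDerivAt_besselK_discriminant (v : ℝ) {x : ℝ} (hx : 0 < x) :
    HasDerivAt (fun x => x * ((x + 1) * besselKIntegral v x ^ 2 +
        2 * v * besselKIntegral v x * besselKIntegral (v + 1) x -
        x * besselKIntegral (v + 1) x ^ 2))
      (2 * besselKIntegral v x ^ 2 * (besselKSlope v x + 1 / 2)) x := by
  have hA := hasDerivAt_besselKIntegral v hx
  have hB := hasDerivAt_besselKIntegral_succ v hx
  have hK := (besselKIntegral_pos v hx).ne'
  have h := (hasDerivAt_id x).mul (((((hasDerivAt_id x).add_const 1).mul (hA.pow 2)).add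
    ((hA.const_mul (2 * v)).mul hB)).sub ((hasDerivAt_id x).mul (hB.pow 2)))
  refine h.congr_deriv ?_
  rw [besselKSlope_eq v hx]
  simp only [Pi.mul_apply, Pi.sub_apply, Pi.add_apply, Pi.pow_apply, id]
  field_simp
  norm_num
  ring

theorem tendsto_besselK_discriminant (v : ℝ) :
    Tendsto (fun x => x * ((x + 1) * besselKIntegral v x ^ 2 +
        2 * v * besselKIntegral v x * besselKIntegral (v + 1) x -
        x * besselKIntegral (v + 1) x ^ 2)) atTop (𝓝 0) := by
  have h0 := tendsto_pow_mul_besselKIntegral_atTop v 0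
  have h1 := tendsto_pow_mul_besselKIntegral_atTop v 1
  have h2 := tendsto_pow_mul_besselKIntegral_atTop (v + 1) 1
  have h := (((h1.mul h1).add (h1.mul h0)).add ((h1.mul (tendsto_pow_mul_besselKIntegral_atTop
    (v + 1) 0)).const_mul (2 * v))).sub (h2.mul h2)
  simp only [mul_zero, add_zero, sub_zero] at h
  exact h.congr fun x => by ring

theorem strictMonoOn_besselKSlope {v : ℝ} (hv : 1 / 2 < v) :
    StrictMonoOn (besselKSlope v) (Set.Ioi 0) := by
  refine strictMonoOn_of_deriv_pos (convex_Ioi 0)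
    (fun y hy => (hasDerivAt_besselKSlope v hy).continuousAt.continuousWithinAt) fun y hy => ?_
  have hy : 0 < y := interior_subset hy
  rw [(hasDerivAt_besselKSlope v hy).deriv]
  have h := pos_of_hasDerivAt_neg_of_tendsto_zero
    (fun y hy => hasDerivAt_besselK_discriminant v hy)
    (fun y hy => mul_neg_of_pos_of_neg (by have := besselKIntegral_pos v hy; positivity)
      (by linarith [besselKSlope_lt_neg_half hv hy])) (tendsto_besselK_discriminant v) hy
  exact div_pos (pos_of_mul_pos_right h hy.le) (pow_pos (besselKIntegral_pos v hy) 2)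

theorem strictAntiOn_besselKSlope {v : ℝ} (hv0 : 0 ≤ v) (hv : v < 1 / 2) :
    StrictAntiOn (besselKSlope v) (Set.Ioi 0) := by
  refine strictAntiOn_of_deriv_neg (convex_Ioi 0)
    (fun y hy => (hasDerivAt_besselKSlope v hy).continuousAt.continuousWithinAt) fun y hy => ?_
  have hy : 0 < y := interior_subset hy
  rw [(hasDerivAt_besselKSlope v hy).deriv]
  have h := neg_of_hasDerivAt_pos_of_tendsto_zero
    (fun y hy => hasDerivAt_besselK_discriminant v hy)
    (fun y hy => mul_pos (by have := besselKIntegral_pos v hy; positivity)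
      (by linarith [neg_half_lt_besselKSlope hv0 hv hy])) (tendsto_besselK_discriminant v) hy
  exact div_neg_of_neg_of_pos (neg_of_mul_neg_right h hy.le) (pow_pos (besselKIntegral_pos v hy) 2)

/-! ### A criterion for a single turning point -/

/-- If h kept a weak sign, F would be monotone, against its blow-up at one of the ends. So h takes
both signs, and strict monotonicity makes its zero the only sign change. -/
theorem exists_strictAntiOn_strictMonoOn {F w h : ℝ → ℝ}
    (hF : ∀ x, 0 < x → HasDerivAt F (w x * h x) x) (hw : ∀ x, 0 < x → 0 < w x)
    (hm : StrictMonoOn h (Set.Ioi 0)) (hc : ContinuousOn h (Set.Ioi 0))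
    (h0 : Tendsto F (𝓝[>] 0) atTop) (h1 : Tendsto F atTop atTop) :
    ∃ x₀, 0 < x₀ ∧ StrictAntiOn F (Set.Ioo 0 x₀) ∧ StrictMonoOn F (Set.Ioi x₀) := by
  have hcont : ∀ s ⊆ Set.Ioi (0 : ℝ), ContinuousOn F s := fun s hs y hy =>
    (hF y (hs hy)).continuousAt.continuousWithinAt
  have hneg : ∃ a, 0 < a ∧ h a < 0 := by
    by_contra! hcon
    have hmono : MonotoneOn F (Set.Ioi 0) := by
      refine monotoneOn_of_deriv_nonneg (convex_Ioi 0) (hcont _ le_rfl)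
        (fun y hy => (hF y (interior_subset hy)).differentiableAt.differentiableWithinAt)
        fun y hy => ?_
      rw [(hF y (interior_subset hy)).deriv]
      exact mul_nonneg (hw y (interior_subset hy)).le (hcon y (interior_subset hy))
    obtain ⟨y, hy1, hy2⟩ :=
      ((h0.eventually_gt_atTop (F 1)).and (Ioo_mem_nhdsGT one_pos)).exists
    exact absurd (hmono hy2.1 (Set.mem_Ioi.2 one_pos) hy2.2.le) (not_le.2 hy1)
  have hpos : ∃ b, 0 < b ∧ 0 < h b := by
    by_contra! hcon
    have hanti : AntitoneOn F (Set.Ioi 0) := by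
      refine antitoneOn_of_deriv_nonpos (convex_Ioi 0) (hcont _ le_rfl)
        (fun y hy => (hF y (interior_subset hy)).differentiableAt.differentiableWithinAt)
        fun y hy => ?_
      rw [(hF y (interior_subset hy)).deriv]
      exact mul_nonpos_of_nonneg_of_nonpos (hw y (interior_subset hy)).le
        (hcon y (interior_subset hy))
    obtain ⟨y, hy1, hy2⟩ :=
      ((h1.eventually_gt_atTop (F 1)).and (eventually_ge_atTop (1 : ℝ))).exists
    exact absurd (hanti (Set.mem_Ioi.2 one_pos) (Set.mem_Ioi.2 (by linarith)) hy2)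
      (not_le.2 hy1)
  obtain ⟨a, ha, hha⟩ := hneg
  obtain ⟨b, hb, hhb⟩ := hpos
  obtain ⟨x₀, hx₀, hz⟩ := (convex_Ioi (0 : ℝ)).isPreconnected.intermediate_value
    (Set.mem_Ioi.2 ha) (Set.mem_Ioi.2 hb) hc ⟨hha.le, hhb.le⟩
  have hx₀ : 0 < x₀ := hx₀
  refine ⟨x₀, hx₀, strictAntiOn_of_deriv_neg (convex_Ioo 0 x₀) (hcont _ fun y hy => hy.1)
    fun y hy => ?_, strictMonoOn_of_deriv_pos (convex_Ioi x₀)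
    (hcont _ fun y hy => hx₀.trans hy) fun y hy => ?_⟩
  · have hy := interior_subset hy
    rw [(hF y hy.1).deriv]
    exact mul_neg_of_pos_of_neg (hw y hy.1) (hz ▸ hm hy.1 hx₀ hy.2)
  · have hy : x₀ < y := interior_subset hy
    rw [(hF y (hx₀.trans hy)).deriv]
    exact mul_pos (hw y (hx₀.trans hy)) (hz ▸ hm hx₀ (hx₀.trans hy) hy)

/-! ### The function f and its limits at both ends -/

theorem powExpBesselK_eq (v r : ℝ) {x : ℝ} (hx : 0 < x) :
    powExpBesselK v r x = x ^ r * Real.exp x * besselKIntegral v x := by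
  rw [powExpBesselK, besselK_eq_besselKIntegral v hx]

theorem powExpBesselK_pos (v r : ℝ) {x : ℝ} (hx : 0 < x) : 0 < powExpBesselK v r x := by
  have := besselKIntegral_pos v hx
  rw [powExpBesselK_eq v r hx]
  positivity

theorem hasDerivAt_powExpBesselK (v r : ℝ) {x : ℝ} (hx : 0 < x) :
    HasDerivAt (powExpBesselK v r) (powExpBesselK v r x / x * (r + besselKSlope v x)) x := by
  refine ((hasDerivAt_rpow_mul_exp_mul_besselKIntegral v r hx).congr_of_eventuallyEq
    ?_).congr_deriv ?_
  · filter_upwards [Ioi_mem_nhds hx] with y hy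
    exact powExpBesselK_eq v r hy
  · rw [powExpBesselK_eq v r hx, Real.rpow_sub_one hx.ne']
    ring

/-- Order 1/2 has slope -1/2, so x^{1/2} e^x K_{1/2} is constant. This makes f a pure power there,
the comparison function at infinity for other orders. -/
theorem powExpBesselK_half {r x : ℝ} (hx : 0 < x) :
    powExpBesselK (1 / 2) r x = x ^ (r - 1 / 2) * powExpBesselK (1 / 2) (1 / 2) 1 := by
  have hd : ∀ y : ℝ, 0 < y → HasDerivAt (powExpBesselK (1 / 2) (1 / 2)) 0 y := by
    intro y hy
    have h := hasDerivAt_powExpBesselK (1 / 2) (1 / 2) hy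
    rwa [besselKSlope_half hy, add_neg_cancel, mul_zero] at h
  have hc : powExpBesselK (1 / 2) (1 / 2) x = powExpBesselK (1 / 2) (1 / 2) 1 :=
    isOpen_Ioi.is_const_of_deriv_eq_zero (convex_Ioi (0 : ℝ)).isPreconnected
      (fun y hy => (hd y hy).differentiableAt.differentiableWithinAt)
      (fun y hy => (hd y hy).deriv) (Set.mem_Ioi.2 hx) (Set.mem_Ioi.2 one_pos)
  rw [← hc, powExpBesselK_eq _ _ hx, powExpBesselK_eq _ _ hx, ← mul_assoc, ← mul_assoc,
    ← Real.rpow_add hx]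
  ring_nf

theorem powExpBesselK_lt {v w : ℝ} (h : |v| < |w|) (r : ℝ) {x : ℝ} (hx : 0 < x) :
    powExpBesselK v r x < powExpBesselK w r x := by
  rw [powExpBesselK_eq v r hx, powExpBesselK_eq w r hx]
  have := besselKIntegral_lt h hx
  gcongr

theorem tendsto_powExpBesselK_atTop_atTop {v r : ℝ} (hv : 1 / 2 < v) (hr : 1 / 2 < r) :
    Tendsto (powExpBesselK v r) atTop atTop := by
  refine tendsto_atTop_mono' _ ?_ ((tendsto_rpow_atTop (sub_pos.2 hr)).atTop_mul_const
    (powExpBesselK_pos (1 / 2) (1 / 2) one_pos))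
  filter_upwards [eventually_gt_atTop 0] with x hx
  rw [← powExpBesselK_half hx]
  refine (powExpBesselK_lt ?_ r hx).le
  rw [abs_of_pos (by linarith : 0 < v), abs_of_pos (by norm_num)]
  exact hv

theorem tendsto_powExpBesselK_atTop_zero {v r : ℝ} (hv0 : 0 ≤ v) (hv : v < 1 / 2)
    (hr : r < 1 / 2) : Tendsto (powExpBesselK v r) atTop (𝓝 0) := by
  have h := (tendsto_rpow_neg_atTop (sub_pos.2 hr)).mul_const (powExpBesselK (1 / 2) (1 / 2) 1)
  rw [zero_mul] at h
  refine squeeze_zero' ?_ ?_ h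
  · filter_upwards [eventually_gt_atTop 0] with x hx
    exact (powExpBesselK_pos v r hx).le
  · filter_upwards [eventually_gt_atTop 0] with x hx
    rw [neg_sub, ← powExpBesselK_half hx]
    refine (powExpBesselK_lt ?_ r hx).le
    rw [abs_of_nonneg hv0, abs_of_pos (by norm_num)]
    exact hv

/-- Its use is the bound K_v(x) ≥ x^{-v} K_v(1) on (0, 1), which gives the blow-up of f at 0 when r
< v. -/
theorem antitoneOn_rpow_mul_besselKIntegral (v : ℝ) :
    AntitoneOn (fun x => x ^ v * besselKIntegral v x) (Set.Ioi 0) := by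
  have hd : ∀ y : ℝ, 0 < y → HasDerivAt (fun x => x ^ v * besselKIntegral v x)
      (-(y ^ v * besselKIntegral (v - 1) y)) y := by
    intro y hy
    refine ((Real.hasDerivAt_rpow_const (p := v) (Or.inl hy.ne')).mul
      (hasDerivAt_besselKIntegral' v hy)).congr_deriv ?_
    rw [Real.rpow_sub_one hy.ne']
    field_simp
    ring
  refine antitoneOn_of_deriv_nonpos (convex_Ioi 0)
    (fun y hy => (hd y hy).continuousAt.continuousWithinAt)
    (fun y hy => (hd y (interior_subset hy)).differentiableAt.differentiableWithinAt)
    fun y hy => ?_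
  have hy : 0 < y := interior_subset hy
  rw [(hd y hy).deriv]
  have := besselKIntegral_pos (v - 1) hy
  exact neg_nonpos.2 (by positivity)

theorem tendsto_powExpBesselK_zero_atTop {v r : ℝ} (hr : r < v) :
    Tendsto (powExpBesselK v r) (𝓝[>] 0) atTop := by
  refine tendsto_atTop_mono' _ ?_ ((tendsto_rpow_neg_nhdsGT_zero (sub_neg.2 hr)).atTop_mul_const
    (besselKIntegral_pos v one_pos))
  filter_upwards [Ioo_mem_nhdsGT one_pos] with x hx
  have hx0 : 0 < x := hx.1
  have h := antitoneOn_rpow_mul_besselKIntegral v hx.1 (Set.mem_Ioi.2 one_pos) hx.2.le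
  simp only [Real.one_rpow, one_mul] at h
  have hK := besselKIntegral_pos v hx0
  calc x ^ (r - v) * besselKIntegral v 1
      ≤ x ^ (r - v) * (x ^ v * besselKIntegral v x) := by gcongr
    _ = x ^ r * 1 * besselKIntegral v x := by
      rw [← mul_assoc, ← Real.rpow_add hx0, sub_add_cancel, mul_one]
    _ ≤ x ^ r * Real.exp x * besselKIntegral v x := by
      gcongr
      exact Real.one_le_exp hx0.le
    _ = powExpBesselK v r x := (powExpBesselK_eq v r hx0).symm

theorem tendsto_powExpBesselK_zero_zero {v r : ℝ} (hv : 0 ≤ v) (hr : v < r) :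
    Tendsto (powExpBesselK v r) (𝓝[>] 0) (𝓝 0) := by
  -- The asymptotics at 0 need a positive order and v may be 0, so K_v is bounded by K_w with v < w
  -- < r.
  obtain ⟨w, hvw, hwr⟩ := exists_between hr
  have hw : 0 < w := hv.trans_lt hvw
  have hrw : 0 < r - w := sub_pos.2 hwr
  have h1 : Tendsto (fun x : ℝ => x ^ (r - w) * Real.exp x) (𝓝[>] 0) (𝓝 0) := by
    have hc : ContinuousAt (fun x : ℝ => x ^ (r - w) * Real.exp x) 0 :=
      (Real.continuousAt_rpow_const 0 (r - w) (Or.inr hrw.le)).mul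
        Real.continuous_exp.continuousAt
    have := hc.tendsto
    rw [Real.zero_rpow hrw.ne', zero_mul] at this
    exact this.mono_left nhdsWithin_le_nhds
  have h := h1.mul (tendsto_rpow_mul_besselKIntegral hw)
  rw [zero_mul] at h
  refine squeeze_zero' ?_ ?_ h
  · filter_upwards [self_mem_nhdsWithin] with x hx
    exact (powExpBesselK_pos v r hx).le
  · filter_upwards [self_mem_nhdsWithin] with x hx
    have hx : 0 < x := hx
    refine (powExpBesselK_lt (w := w) ?_ r hx).le.trans_eq ?_
    · rwa [abs_of_nonneg hv, abs_of_pos hw]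
    · rw [powExpBesselK_eq w r hx, mul_right_comm (x ^ (r - w)), ← mul_assoc (x ^ (r - w)),
        ← Real.rpow_add hx, sub_add_cancel]
      ring

theorem continuousOn_besselKSlope (v : ℝ) : ContinuousOn (besselKSlope v) (Set.Ioi 0) :=
  fun _ hy => (hasDerivAt_besselKSlope v hy).continuousAt.continuousWithinAt

/-! ### Turning points and the monotonicity thresholds -/

theorem powExpBesselK_valley {v r : ℝ} (hr : 1 / 2 < r) (hrv : r < v) :
    ∃ x₀, 0 < x₀ ∧ StrictAntiOn (powExpBesselK v r) (Set.Ioo 0 x₀) ∧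
      StrictMonoOn (powExpBesselK v r) (Set.Ioi x₀) := by
  have hv := hr.trans hrv
  exact exists_strictAntiOn_strictMonoOn (fun x hx => hasDerivAt_powExpBesselK v r hx)
    (fun x hx => div_pos (powExpBesselK_pos v r hx) hx)
    (fun x hx y hy hxy => by
      have := strictMonoOn_besselKSlope hv hx hy hxy
      linarith)
    (continuousOn_const.add (continuousOn_besselKSlope v))
    (tendsto_powExpBesselK_zero_atTop hrv) (tendsto_powExpBesselK_atTop_atTop hv hr)

theorem powExpBesselK_peak {v r : ℝ} (hv : 0 ≤ v) (hvr : v < r) (hr : r < 1 / 2) :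
    ∃ x₀, 0 < x₀ ∧ StrictMonoOn (powExpBesselK v r) (Set.Ioo 0 x₀) ∧
      StrictAntiOn (powExpBesselK v r) (Set.Ioi x₀) := by
  have hv2 := hvr.trans hr
  have hpos : ∀ᶠ x in 𝓝[>] (0 : ℝ), powExpBesselK v r x ∈ Set.Ioi 0 := by
    filter_upwards [self_mem_nhdsWithin] with x hx
    exact powExpBesselK_pos v r hx
  have hpos' : ∀ᶠ x in (atTop : Filter ℝ), powExpBesselK v r x ∈ Set.Ioi 0 := by
    filter_upwards [eventually_gt_atTop 0] with x hx
    exact powExpBesselK_pos v r hx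
  -- The criterion is applied to 1/f, which blows up at both ends because f is positive and tends to
  -- 0 there.
  obtain ⟨x₀, hx₀, h1, h2⟩ := exists_strictAntiOn_strictMonoOn
    (F := fun x => (powExpBesselK v r x)⁻¹) (w := fun x => (powExpBesselK v r x)⁻¹ / x)
    (h := fun x => -(r + besselKSlope v x))
    (fun x hx => ((hasDerivAt_powExpBesselK v r hx).fun_inv
      (powExpBesselK_pos v r hx).ne').congr_deriv (by
        have := (powExpBesselK_pos v r hx).ne'
        field_simp))
    (fun x hx => div_pos (inv_pos.2 (powExpBesselK_pos v r hx)) hx)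
    (fun x hx y hy hxy => by
      have := strictAntiOn_besselKSlope hv hv2 hx hy hxy
      simp only
      linarith)
    (continuousOn_const.add (continuousOn_besselKSlope v)).neg
    (tendsto_inv_nhdsGT_zero.comp (tendsto_nhdsWithin_iff.2
      ⟨tendsto_powExpBesselK_zero_zero hv hvr, hpos⟩))
    (tendsto_inv_nhdsGT_zero.comp (tendsto_nhdsWithin_iff.2
      ⟨tendsto_powExpBesselK_atTop_zero hv hv2 hr, hpos'⟩))
  refine ⟨x₀, hx₀, fun x hx y hy hxy => ?_, fun x hx y hy hxy => ?_⟩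
  · exact (inv_lt_inv₀ (powExpBesselK_pos v r hy.1) (powExpBesselK_pos v r hx.1)).1
      (h1 hx hy hxy)
  · exact (inv_lt_inv₀ (powExpBesselK_pos v r (hx₀.trans hx))
      (powExpBesselK_pos v r (hx₀.trans hy))).1 (h2 hx hy hxy)

theorem strictMonoOn_powExpBesselK {v r : ℝ} (h : ∀ x, 0 < x → -r < besselKSlope v x) :
    StrictMonoOn (powExpBesselK v r) (Set.Ioi 0) := by
  refine strictMonoOn_of_deriv_pos (convex_Ioi 0)
    (fun y hy => (hasDerivAt_powExpBesselK v r hy).continuousAt.continuousWithinAt) fun y hy => ?_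
  have hy : 0 < y := interior_subset hy
  rw [(hasDerivAt_powExpBesselK v r hy).deriv]
  exact mul_pos (div_pos (powExpBesselK_pos v r hy) hy) (by linarith [h y hy])

theorem strictAntiOn_powExpBesselK {v r : ℝ} (h : ∀ x, 0 < x → besselKSlope v x < -r) :
    StrictAntiOn (powExpBesselK v r) (Set.Ioi 0) := by
  refine strictAntiOn_of_deriv_neg (convex_Ioi 0)
    (fun y hy => (hasDerivAt_powExpBesselK v r hy).continuousAt.continuousWithinAt) fun y hy => ?_
  have hy : 0 < y := interior_subset hy
  rw [(hasDerivAt_powExpBesselK v r hy).deriv]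
  exact mul_neg_of_pos_of_neg (div_pos (powExpBesselK_pos v r hy) hy) (by linarith [h y hy])

theorem StrictAntiOn.not_monotoneOn_of_lt {f : ℝ → ℝ} {s t : Set ℝ} (h : StrictAntiOn f s)
    (hst : s ⊆ t) {a b : ℝ} (ha : a ∈ s) (hb : b ∈ s) (hab : a < b) : ¬ MonotoneOn f t :=
  fun hm => (h ha hb hab).not_ge (hm (hst ha) (hst hb) hab.le)

theorem StrictMonoOn.not_antitoneOn_of_lt {f : ℝ → ℝ} {s t : Set ℝ} (h : StrictMonoOn f s)
    (hst : s ⊆ t) {a b : ℝ} (ha : a ∈ s) (hb : b ∈ s) (hab : a < b) : ¬ AntitoneOn f t :=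
  fun hm => (h ha hb hab).not_ge (hm (hst ha) (hst hb) hab.le)

theorem monotonicity_iff_of_thresholds {f : ℝ → ℝ} {m M r : ℝ}
    (hM : M ≤ r → StrictMonoOn f (Set.Ioi 0)) (hm : r ≤ m → StrictAntiOn f (Set.Ioi 0))
    (hmid : m < r → r < M → ¬ MonotoneOn f (Set.Ioi 0) ∧ ¬ AntitoneOn f (Set.Ioi 0)) :
    ((MonotoneOn f (Set.Ioi 0) ↔ M ≤ r) ∧ (AntitoneOn f (Set.Ioi 0) ↔ r ≤ m)) ∧
      (StrictMonoOn f (Set.Ioi 0) ↔ M ≤ r) ∧ (StrictAntiOn f (Set.Ioi 0) ↔ r ≤ m) := by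
  have h1 : (1 : ℝ) ∈ Set.Ioi (0 : ℝ) := Set.mem_Ioi.2 one_pos
  have h2 : (2 : ℝ) ∈ Set.Ioi (0 : ℝ) := Set.mem_Ioi.2 two_pos
  have hmono : MonotoneOn f (Set.Ioi 0) → M ≤ r := by
    intro h
    by_contra! hr
    rcases le_or_gt r m with hrm | hrm
    · exact (hm hrm).not_monotoneOn_of_lt le_rfl h1 h2 one_lt_two h
    · exact (hmid hrm hr).1 h
  have hanti : AntitoneOn f (Set.Ioi 0) → r ≤ m := by
    intro h
    by_contra! hr
    rcases le_or_gt M r with hrm | hrm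
    · exact (hM hrm).not_antitoneOn_of_lt le_rfl h1 h2 one_lt_two h
    · exact (hmid hr hrm).2 h
  exact ⟨⟨⟨hmono, fun h => (hM h).monotoneOn⟩, ⟨hanti, fun h => (hm h).antitoneOn⟩⟩,
    ⟨fun h => hmono h.monotoneOn, hM⟩, ⟨fun h => hanti h.antitoneOn, hm⟩⟩

theorem mainTheorem6 (v r : ℝ) (hv : 0 ≤ v) :
    (MonotoneOn (powExpBesselK v r) (Set.Ioi 0) ↔ max v (1 / 2) ≤ r) ∧
    (AntitoneOn (powExpBesselK v r) (Set.Ioi 0) ↔ r ≤ min v (1 / 2)) ∧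
    (¬ (v = 1 / 2 ∧ r = 1 / 2) →
      (StrictMonoOn (powExpBesselK v r) (Set.Ioi 0) ↔ max v (1 / 2) ≤ r) ∧
      (StrictAntiOn (powExpBesselK v r) (Set.Ioi 0) ↔ r ≤ min v (1 / 2))) ∧
    (1 / 2 < r → r < v → ∃ x₀ : ℝ, 0 < x₀ ∧
      StrictAntiOn (powExpBesselK v r) (Set.Ioo 0 x₀) ∧
      StrictMonoOn (powExpBesselK v r) (Set.Ioi x₀)) ∧
    (v < r → r < 1 / 2 → ∃ x₀ : ℝ, 0 < x₀ ∧
      StrictMonoOn (powExpBesselK v r) (Set.Ioo 0 x₀) ∧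
      StrictAntiOn (powExpBesselK v r) (Set.Ioi x₀)) := by
  suffices h : ((MonotoneOn (powExpBesselK v r) (Set.Ioi 0) ↔ max v (1 / 2) ≤ r) ∧
      (AntitoneOn (powExpBesselK v r) (Set.Ioi 0) ↔ r ≤ min v (1 / 2))) ∧
      (¬ (v = 1 / 2 ∧ r = 1 / 2) →
        (StrictMonoOn (powExpBesselK v r) (Set.Ioi 0) ↔ max v (1 / 2) ≤ r) ∧
        (StrictAntiOn (powExpBesselK v r) (Set.Ioi 0) ↔ r ≤ min v (1 / 2))) from
    ⟨h.1.1, h.1.2, h.2, powExpBesselK_valley, powExpBesselK_peak hv⟩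
  -- Two points on each side of x₀: a strict trend between them refutes the opposite weak
  -- monotonicity.
  have hmem : ∀ x₀ : ℝ, 0 < x₀ → x₀ / 3 ∈ Set.Ioo 0 x₀ ∧ x₀ / 2 ∈ Set.Ioo 0 x₀ ∧
      x₀ + 1 ∈ Set.Ioi x₀ ∧ x₀ + 2 ∈ Set.Ioi x₀ ∧ x₀ / 3 < x₀ / 2 := fun x₀ hx₀ =>
    ⟨⟨by linarith, by linarith⟩, ⟨by linarith, by linarith⟩, Set.mem_Ioi.2 (by linarith),
      Set.mem_Ioi.2 (by linarith), by linarith⟩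
  rcases lt_trichotomy v (1 / 2) with h | rfl | h
  · rw [max_eq_right h.le, min_eq_left h.le]
    have := monotonicity_iff_of_thresholds (f := powExpBesselK v r) (m := v) (M := 1 / 2) (r := r)
      (fun hr => strictMonoOn_powExpBesselK fun x hx => by
        linarith [neg_half_lt_besselKSlope hv h hx])
      (fun hr => strictAntiOn_powExpBesselK fun x hx => by
        linarith [besselKSlope_lt_neg_order hv h hx])
      (fun h1 h2 => by
        obtain ⟨x₀, hx₀, hi, ha⟩ := powExpBesselK_peak hv h1 h2
        obtain ⟨m1, m2, m3, m4, m5⟩ := hmem x₀ hx₀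
        exact ⟨ha.not_monotoneOn_of_lt (Set.Ioi_subset_Ioi hx₀.le) m3 m4 (by linarith),
          hi.not_antitoneOn_of_lt Set.Ioo_subset_Ioi_self m1 m2 m5⟩)
    exact ⟨this.1, fun _ => this.2⟩
  · rw [max_self, min_self]
    rcases eq_or_ne r (1 / 2) with rfl | hr
    · have hc : Set.EqOn (powExpBesselK (1 / 2) (1 / 2))
          (fun _ => powExpBesselK (1 / 2) (1 / 2) 1) (Set.Ioi 0) := by
        intro x hx
        rw [powExpBesselK_half hx, sub_self, Real.rpow_zero, one_mul]
      refine ⟨⟨⟨fun _ => le_rfl, fun _ => ?_⟩, ⟨fun _ => le_rfl, fun _ => ?_⟩⟩,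
        fun hne => absurd ⟨rfl, rfl⟩ hne⟩
      · exact monotoneOn_const.congr hc.symm
      · exact antitoneOn_const.congr hc.symm
    -- The thresholds coincide, so the middle range is empty, and r ≠ 1/2 makes the weak
    -- inequalities strict.
    · have := monotonicity_iff_of_thresholds (f := powExpBesselK (1 / 2) r) (m := 1 / 2)
        (M := 1 / 2) (r := r)
        (fun hr1 => strictMonoOn_powExpBesselK fun x hx => by
          have := lt_of_le_of_ne hr1 hr.symm
          rw [besselKSlope_half hx]
          linarith)
        (fun hr1 => strictAntiOn_powExpBesselK fun x hx => by
          have := lt_of_le_of_ne hr1 hr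
          rw [besselKSlope_half hx]
          linarith)
        (fun h1 h2 => absurd h2 h1.not_gt)
      exact ⟨this.1, fun _ => this.2⟩
  · rw [max_eq_left h.le, min_eq_right h.le]
    have := monotonicity_iff_of_thresholds (f := powExpBesselK v r) (m := 1 / 2) (M := v) (r := r)
      (fun hr => strictMonoOn_powExpBesselK fun x hx => by
        linarith [neg_order_lt_besselKSlope h hx])
      (fun hr => strictAntiOn_powExpBesselK fun x hx => by
        linarith [besselKSlope_lt_neg_half h hx])
      (fun h1 h2 => by
        obtain ⟨x₀, hx₀, ha, hi⟩ := powExpBesselK_valley h1 h2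
        obtain ⟨m1, m2, m3, m4, m5⟩ := hmem x₀ hx₀
        exact ⟨ha.not_monotoneOn_of_lt Set.Ioo_subset_Ioi_self m1 m2 m5,
          hi.not_antitoneOn_of_lt (Set.Ioi_subset_Ioi hx₀.le) m3 m4 (by linarith)⟩)
    exact ⟨this.1, fun _ => this.2⟩
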